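/- **Theorem (class $\mathcal{B}$).** Let $(M_1,g_1)$ and $(M_2,g_2)$ be nonempty smooth pseudo-Riemannian manifolds (without boundary, of any signature) of dimensions $n_1,n_2$, let $n=n_1+n_2$, and let $f_1:M_1\to(0,\infty)$, $f_2:M_2\to(0,\infty)$ be smooth. Let $M={}_{f_2}M_1\times_{f_1}M_2$ be the doubly warped product, i.e. $M_1\times M_2$ with the metric $$g=(f_2\circ\pi_2)^2\,\pi_1^*g_1\oplus(f_1\circ\pi_1)^2\,\pi_2^*g_2 .$$ For $\{i,j\}=\{1,2\}$ let $D^i$ be the Levi-Civita connection of $g_i$, $\nabla^i$ its gradient, $\Delta^i$ its Laplacian (the trace of the Hessian), and $H^{f_i}$ the Hessian of $f_i$ with respect to $g_i$. Put $$\mathcal{F}^i=\frac{n_j}{f_i}H^{f_i},\qquad f_i^{\diamond}=f_i\,\Delta^i f_i+(n_j-1)\,g_i(\nabla^i f_i,\nabla^i f_i).$$ A pseudo-Riemannian manifold with Levi-Civita connection $D$ is of class $\mathcal{B}$ if its Ricci tensor is a Codazzi tensor, i.e. $(D_X\mathrm{Ric})(Y,Z)=(D_Y\mathrm{Ric})(X,Z)$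 for all $X,Y,Z$. Suppose that $M$ is of class $\mathcal{B}$. Then for each $i\in\{1,2\}$, with $j\neq i$, the factor $(M_i,g_i)$ is of class $\mathcal{B}$ if and only if $$\begin{aligned}(D^i_{X}\mathcal{F}^i)(Y,Z)={}&(D^i_{Y}\mathcal{F}^i)(X,Z)+\frac{1}{f_i^3}X(f_i)\,g_i(Y,Z)\bigl(2f_j^{\diamond}-(n-2)(\nabla^jf_j)f_j\bigr)\\&-\frac{1}{f_i^3}Y(f_i)\,g_i(X,Z)\bigl(2f_j^{\diamond}-(n-2)(\nabla^jf_j)f_j\bigr)\end{aligned}$$ holds at every point of $M_1\times M_2$ for all $X,Y,Z$ tangent to $M_i$, where $(\nabla^jf_j)f_j$ denotes the derivative of $f_j$ along its gradient. -/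

import Mathlib

set_option maxSynthPendingDepth 3

open scoped Manifold ContDiff

noncomputable section

/-! ### Tensor calculus of a metric in coordinates

`G : E → E →L[ℝ] E →L[ℝ] ℝ` is the coordinate expression of a pseudo-Riemannian metric on an open
subset of a finite-dimensional real vector space `E`; `G y u v` is the value at `y` on the constant
vectors `u`, `v`. -/

namespace Coord

variable {E : Type*} [NormedAddCommGroup E] [NormedSpace ℝ E]

/-- Raising an index: the inverse of the isomorphism `v ↦ G y v ·`. -/
def sharp (G : E → E →L[ℝ] E →L[ℝ] ℝ) (y : E) : (E →L[ℝ] ℝ) →L[ℝ] E :=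
  (G y).inverse

/-- Christoffel symbols of the first kind:
`(u, v, w) ↦ (∂_u G(v, w) + ∂_v G(u, w) - ∂_w G(u, v)) / 2`. -/
def christoffelFirst (G : E → E →L[ℝ] E →L[ℝ] ℝ) (y : E) :
    E →L[ℝ] E →L[ℝ] E →L[ℝ] ℝ :=
  (1 / 2 : ℝ) • (fderiv ℝ G y + (fderiv ℝ G y).flip
    - ((ContinuousLinearMap.flipₗᵢ ℝ E E ℝ).toContinuousLinearEquiv :
        (E →L[ℝ] E →L[ℝ] ℝ) →L[ℝ] E →L[ℝ] E →L[ℝ] ℝ) ∘L (fderiv ℝ G y).flip)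

theorem christoffelFirst_apply (G : E → E →L[ℝ] E →L[ℝ] ℝ) (y u v w : E) :
    christoffelFirst G y u v w =
      (fderiv ℝ G y u v w + fderiv ℝ G y v u w - fderiv ℝ G y w u v) / 2 := by
  simp [christoffelFirst]
  ring

/-- Christoffel symbols of the second kind, `christoffel G y u v = Γ(u, v)`, so that the Levi-Civita
connection of `G` is `D_X Y = ∂_X Y + Γ(X, Y)`. -/
def christoffel (G : E → E →L[ℝ] E →L[ℝ] ℝ) (y : E) : E →L[ℝ] E →L[ℝ] E :=
  (ContinuousLinearMap.compL ℝ E (E →L[ℝ] ℝ) E (sharp G y)) ∘L christoffelFirst G y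

theorem christoffel_apply (G : E → E →L[ℝ] E →L[ℝ] ℝ) (y u v : E) :
    christoffel G y u v = sharp G y (christoffelFirst G y u v) := rfl

/-- The endomorphism `u ↦ R(u, v) w`, with the convention
`R(X, Y) Z = D_X D_Y Z - D_Y D_X Z - D_[X, Y] Z`. -/
def riemann (G : E → E →L[ℝ] E →L[ℝ] ℝ) (y v w : E) : E →L[ℝ] E :=
  ((fderiv ℝ (christoffel G) y).flip v).flip w
    - (fderiv ℝ (christoffel G) y v).flip w
    + (christoffel G y).flip (christoffel G y v w)
    - (christoffel G y v) ∘L (christoffel G y).flip w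

theorem riemann_apply (G : E → E →L[ℝ] E →L[ℝ] ℝ) (y u v w : E) :
    riemann G y v w u =
      fderiv ℝ (christoffel G) y u v w - fderiv ℝ (christoffel G) y v u w
        + christoffel G y u (christoffel G y v w) - christoffel G y v (christoffel G y u w) := by
  simp [riemann]

/-- The Ricci tensor `Ric(v, w) = trace (u ↦ R(u, v) w)`. -/
def ricci (G : E → E →L[ℝ] E →L[ℝ] ℝ) (y v w : E) : ℝ :=
  LinearMap.trace ℝ E (riemann G y v w).toLinearMap

/-- The covariant derivative `(D_u T)(v, w)` of a `(0,2)` tensor field `T`. -/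
def covDeriv (G : E → E →L[ℝ] E →L[ℝ] ℝ) (T : E → E → E → ℝ) (y u v w : E) : ℝ :=
  fderiv ℝ (fun z => T z v w) y u
    - T y (christoffel G y u v) w - T y v (christoffel G y u w)

/-- The Hessian `H^f(u, v) = u(v(f)) - (D_u v)(f)` of a function `f`. -/
def hessian (G : E → E →L[ℝ] E →L[ℝ] ℝ) (f : E → ℝ) (y : E) : E →L[ℝ] E →L[ℝ] ℝ :=
  fderiv ℝ (fderiv ℝ f) y
    - (ContinuousLinearMap.compL ℝ E E ℝ (fderiv ℝ f y)) ∘L christoffel G y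

theorem hessian_apply (G : E → E →L[ℝ] E →L[ℝ] ℝ) (f : E → ℝ) (y u v : E) :
    hessian G f y u v = fderiv ℝ (fderiv ℝ f) y u v - fderiv ℝ f y (christoffel G y u v) := by
  simp [hessian]

/-- The Laplacian of `f`, the trace of the Hessian with respect to `G`. -/
def laplacian (G : E → E →L[ℝ] E →L[ℝ] ℝ) (f : E → ℝ) (y : E) : ℝ :=
  LinearMap.trace ℝ E (sharp G y ∘L hessian G f y).toLinearMap

end Coord

/-! ### Pseudo-Riemannian manifolds -/

section Manifold

variable {E : Type*} [NormedAddCommGroup E] [NormedSpace ℝ E]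
  {H : Type*} [TopologicalSpace H] (I : ModelWithCorners ℝ E H)
  {M : Type*} [TopologicalSpace M] [ChartedSpace H M]

/-- The coordinate expression, in the chart of `M` at `x`, of a field `b` of bilinear forms on the
tangent spaces: the pullback of `b` under the inverse of the chart. -/
def formInChart (b : (p : M) → TangentSpace I p →L[ℝ] TangentSpace I p →L[ℝ] ℝ) (x : M) (y : E) :
    E →L[ℝ] E →L[ℝ] ℝ :=
  ContinuousLinearMap.bilinearComp (E := E) (F := E) (b ((extChartAt I x).symm y))
    (mfderivWithin 𝓘(ℝ, E) I (extChartAt I x).symm (Set.range I) y)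
    (mfderivWithin 𝓘(ℝ, E) I (extChartAt I x).symm (Set.range I) y)

variable (M) in
/-- A smooth pseudo-Riemannian metric on `M`, of any signature. -/
structure PseudoRiemannianMetric where
  /-- The scalar product on each tangent space. -/
  val : (p : M) → TangentSpace I p →L[ℝ] TangentSpace I p →L[ℝ] ℝ
  symm : ∀ (p : M) (u v : TangentSpace I p), val p u v = val p v u
  nondegenerate : ∀ (p : M) (u : TangentSpace I p), (∀ v, val p u v = 0) → u = 0
  smooth : ∀ x : M, ContDiffOn ℝ ∞ (formInChart I val x) (extChartAt I x).target

namespace PseudoRiemannianMetric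

variable {I} (g : PseudoRiemannianMetric I M)

/-- The coordinate expression of the metric in the chart at `x`. -/
def inChart (x : M) : E → E →L[ℝ] E →L[ℝ] ℝ :=
  formInChart I g.val x

/-- The Ricci tensor at `p`. The tangent space at `p` is identified with the model space `E` by
means of the chart at `p`. -/
def ricci (p : M) (u v : TangentSpace I p) : ℝ :=
  Coord.ricci (g.inChart p) (extChartAt I p p) u v

/-- The covariant derivative `(D_u Ric)(v, w)` of the Ricci tensor at `p`. -/
def covDerivRicci (p : M) (u v w : TangentSpace I p) : ℝ :=
  Coord.covDeriv (g.inChart p) (Coord.ricci (g.inChart p)) (extChartAt I p p) u v w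

/-- The Ricci tensor is a Codazzi tensor: the metric is Einstein-like of class `ℬ`. -/
def IsClassB : Prop :=
  ∀ (p : M) (u v w : TangentSpace I p), g.covDerivRicci p u v w = g.covDerivRicci p v u w

/-- The Laplacian of `f` at `p`. -/
def laplacian (f : M → ℝ) (p : M) : ℝ :=
  Coord.laplacian (g.inChart p) (f ∘ (extChartAt I p).symm) (extChartAt I p p)

/-- The gradient of `f` at `p`: the vector with `g (grad f) v = df v` for all `v`. -/
def gradient (f : M → ℝ) (p : M) : TangentSpace I p :=
  (g.val p).inverse (mvfderiv I f p)

/-- The function `f^◇ = f Δf + (m - 1) g(∇f, ∇f)`. -/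
def diamond (m : ℕ) (f : M → ℝ) (p : M) : ℝ :=
  f p * g.laplacian f p + ((m : ℝ) - 1) * g.val p (g.gradient f p) (g.gradient f p)

/-- The covariant derivative `(D_u F)(v, w)` at `p` of the tensor field `F = (m / f) H^f`. -/
def covDerivF (m : ℕ) (f : M → ℝ) (p : M) (u v w : TangentSpace I p) : ℝ :=
  Coord.covDeriv (g.inChart p)
    (fun y v w => (m : ℝ) / f ((extChartAt I p).symm y) *
      Coord.hessian (g.inChart p) (f ∘ (extChartAt I p).symm) y v w)
    (extChartAt I p p) u v w

end PseudoRiemannianMetric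

end Manifold

/-! ### Doubly warped products -/

section DoublyWarped

variable {E₁ : Type*} [NormedAddCommGroup E₁] [NormedSpace ℝ E₁]
  {H₁ : Type*} [TopologicalSpace H₁] {I₁ : ModelWithCorners ℝ E₁ H₁}
  {M₁ : Type*} [TopologicalSpace M₁] [ChartedSpace H₁ M₁]
  {E₂ : Type*} [NormedAddCommGroup E₂] [NormedSpace ℝ E₂]
  {H₂ : Type*} [TopologicalSpace H₂] {I₂ : ModelWithCorners ℝ E₂ H₂}
  {M₂ : Type*} [TopologicalSpace M₂] [ChartedSpace H₂ M₂]

theorem contDiffOn_bilinearComp {F : Type*} [NormedAddCommGroup F] [NormedSpace ℝ F]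
    {F' : Type*} [NormedAddCommGroup F'] [NormedSpace ℝ F'] {s : Set F'}
    {G : F' → E₁ →L[ℝ] E₁ →L[ℝ] ℝ} (hG : ContDiffOn ℝ ∞ G s) (L : F →L[ℝ] E₁) :
    ContDiffOn ℝ ∞ (fun y => (G y).bilinearComp L L) s := by
  have h : ∀ B : E₁ →L[ℝ] E₁ →L[ℝ] ℝ, B.bilinearComp L L =
      ((ContinuousLinearMap.compL ℝ F E₁ ℝ).flip L ∘L B) ∘L L := fun B => rfl
  simp only [h]
  exact (contDiffOn_const.clm_comp hG).clm_comp contDiffOn_const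

/-- The form `f₂² g₁ ⊕ f₁² g₂` on `M₁ × M₂`, whose tangent space at `p` is `E₁ × E₂`. -/
def doublyWarpedForm (g₁ : PseudoRiemannianMetric I₁ M₁) (g₂ : PseudoRiemannianMetric I₂ M₂)
    (f₁ : M₁ → ℝ) (f₂ : M₂ → ℝ) (p : M₁ × M₂) :
    TangentSpace (I₁.prod I₂) p →L[ℝ] TangentSpace (I₁.prod I₂) p →L[ℝ] ℝ :=
  (f₂ p.2 ^ 2) • ContinuousLinearMap.bilinearComp (E := E₁) (F := E₁) (g₁.val p.1)
      (ContinuousLinearMap.fst ℝ E₁ E₂) (ContinuousLinearMap.fst ℝ E₁ E₂)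
    + (f₁ p.1 ^ 2) • ContinuousLinearMap.bilinearComp (E := E₂) (F := E₂) (g₂.val p.2)
      (ContinuousLinearMap.snd ℝ E₁ E₂) (ContinuousLinearMap.snd ℝ E₁ E₂)

theorem doublyWarpedForm_apply (g₁ : PseudoRiemannianMetric I₁ M₁)
    (g₂ : PseudoRiemannianMetric I₂ M₂) (f₁ : M₁ → ℝ) (f₂ : M₂ → ℝ) (p : M₁ × M₂)
    (u v : TangentSpace (I₁.prod I₂) p) :
    doublyWarpedForm g₁ g₂ f₁ f₂ p u v =
      f₂ p.2 ^ 2 * g₁.val p.1 u.1 v.1 + f₁ p.1 ^ 2 * g₂.val p.2 u.2 v.2 := rfl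

theorem formInChart_doublyWarpedForm [IsManifold I₁ ∞ M₁] [IsManifold I₂ ∞ M₂]
    (g₁ : PseudoRiemannianMetric I₁ M₁) (g₂ : PseudoRiemannianMetric I₂ M₂)
    (f₁ : M₁ → ℝ) (f₂ : M₂ → ℝ) (x : M₁ × M₂) {y : E₁ × E₂}
    (hy₁ : y.1 ∈ (extChartAt I₁ x.1).target) (hy₂ : y.2 ∈ (extChartAt I₂ x.2).target) :
    formInChart (I₁.prod I₂) (doublyWarpedForm g₁ g₂ f₁ f₂) x y =
      (f₂ ((extChartAt I₂ x.2).symm y.2) ^ 2) • (g₁.inChart x.1 y.1).bilinearComp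
        (ContinuousLinearMap.fst ℝ E₁ E₂) (ContinuousLinearMap.fst ℝ E₁ E₂)
      + (f₁ ((extChartAt I₁ x.1).symm y.1) ^ 2) • (g₂.inChart x.2 y.2).bilinearComp
        (ContinuousLinearMap.snd ℝ E₁ E₂) (ContinuousLinearMap.snd ℝ E₁ E₂) := by
  have hD : mfderivWithin 𝓘(ℝ, E₁ × E₂) (I₁.prod I₂) (extChartAt (I₁.prod I₂) x).symm
      (Set.range (I₁.prod I₂)) y =
      (mfderivWithin 𝓘(ℝ, E₁) I₁ (extChartAt I₁ x.1).symm (Set.range I₁) y.1).prodMap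
        (mfderivWithin 𝓘(ℝ, E₂) I₂ (extChartAt I₂ x.2).symm (Set.range I₂) y.2) := by
    have r₁ : Set.MapsTo Prod.fst (Set.range (I₁.prod I₂)) (Set.range I₁) := by
      rintro _ ⟨z, rfl⟩
      exact ⟨z.1, rfl⟩
    have r₂ : Set.MapsTo Prod.snd (Set.range (I₁.prod I₂)) (Set.range I₂) := by
      rintro _ ⟨z, rfl⟩
      exact ⟨z.2, rfl⟩
    have a₁ := (mdifferentiableWithinAt_extChartAt_symm hy₁).hasMFDerivWithinAt.comp y
      (hasFDerivWithinAt_fst (𝕜 := ℝ) (E := E₁) (F := E₂) (p := y)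
        (s := Set.range (I₁.prod I₂))).hasMFDerivWithinAt r₁
    have a₂ := (mdifferentiableWithinAt_extChartAt_symm hy₂).hasMFDerivWithinAt.comp y
      (hasFDerivWithinAt_snd (𝕜 := ℝ) (E := E₁) (F := E₂) (p := y)
        (s := Set.range (I₁.prod I₂))).hasMFDerivWithinAt r₂
    have hy : y ∈ Set.range (I₁.prod I₂) := by
      have hy' : y ∈ (extChartAt (I₁.prod I₂) x).target := by
        rw [extChartAt_prod]
        exact ⟨hy₁, hy₂⟩
      exact extChartAt_target_subset_range x hy'
    have hu : UniqueMDiffWithinAt 𝓘(ℝ, E₁ × E₂) (Set.range (I₁.prod I₂)) y :=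
      ((I₁.prod I₂).uniqueDiffOn y hy).uniqueMDiffWithinAt
    have hs : ⇑(extChartAt (I₁.prod I₂) x).symm =
        fun z : E₁ × E₂ => ((extChartAt I₁ x.1).symm z.1, (extChartAt I₂ x.2).symm z.2) := by
      rw [extChartAt_prod]
      rfl
    rw [hs]
    exact (a₁.prodMk a₂).mfderivWithin hu
  have hb : ∀ u v : E₁ × E₂, formInChart (I₁.prod I₂) (doublyWarpedForm g₁ g₂ f₁ f₂) x y u v =
      doublyWarpedForm g₁ g₂ f₁ f₂ ((extChartAt (I₁.prod I₂) x).symm y)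
        (mfderivWithin 𝓘(ℝ, E₁ × E₂) (I₁.prod I₂) (extChartAt (I₁.prod I₂) x).symm
          (Set.range (I₁.prod I₂)) y u)
        (mfderivWithin 𝓘(ℝ, E₁ × E₂) (I₁.prod I₂) (extChartAt (I₁.prod I₂) x).symm
          (Set.range (I₁.prod I₂)) y v) := fun _ _ => rfl
  refine ContinuousLinearMap.ext fun u => ContinuousLinearMap.ext fun v => ?_
  rw [hb, hD]
  rfl

/-- The doubly warped product metric `g = (f₂ ∘ π₂)² π₁^* g₁ ⊕ (f₁ ∘ π₁)² π₂^* g₂` on `M₁ × M₂`. -/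
def doublyWarpedMetric [IsManifold I₁ ∞ M₁] [IsManifold I₂ ∞ M₂]
    (g₁ : PseudoRiemannianMetric I₁ M₁) (g₂ : PseudoRiemannianMetric I₂ M₂)
    (f₁ : M₁ → ℝ) (f₂ : M₂ → ℝ) (hf₁ : ContMDiff I₁ 𝓘(ℝ, ℝ) ∞ f₁) (hf₂ : ContMDiff I₂ 𝓘(ℝ, ℝ) ∞ f₂)
    (hpos₁ : ∀ p, 0 < f₁ p) (hpos₂ : ∀ p, 0 < f₂ p) :
    PseudoRiemannianMetric (I₁.prod I₂) (M₁ × M₂) where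
  val := doublyWarpedForm g₁ g₂ f₁ f₂
  symm p u v :=
    congrArg₂ (fun a b => f₂ p.2 ^ 2 * a + f₁ p.1 ^ 2 * b) (g₁.symm p.1 u.1 v.1) (g₂.symm p.2 u.2 v.2)
  nondegenerate p u h := by
    refine Prod.ext (g₁.nondegenerate p.1 u.1 fun v => ?_) (g₂.nondegenerate p.2 u.2 fun v => ?_)
    · have h1 : f₂ p.2 ^ 2 * g₁.val p.1 u.1 v + f₁ p.1 ^ 2 * g₂.val p.2 u.2 0 = 0 := h (v, 0)
      rw [map_zero, mul_zero, add_zero] at h1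
      exact (mul_eq_zero.mp h1).resolve_left (pow_pos (hpos₂ p.2) 2).ne'
    · have h2 : f₂ p.2 ^ 2 * g₁.val p.1 u.1 0 + f₁ p.1 ^ 2 * g₂.val p.2 u.2 v = 0 := h (0, v)
      rw [map_zero, mul_zero, zero_add] at h2
      exact (mul_eq_zero.mp h2).resolve_left (pow_pos (hpos₁ p.1) 2).ne'
  smooth x := by
    have e : ∀ y ∈ (extChartAt (I₁.prod I₂) x).target,
        y.1 ∈ (extChartAt I₁ x.1).target ∧ y.2 ∈ (extChartAt I₂ x.2).target := by
      intro y hy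
      rw [extChartAt_prod] at hy
      exact hy
    have c₁ : ContDiffOn ℝ ∞ (f₁ ∘ (extChartAt I₁ x.1).symm) (extChartAt I₁ x.1).target :=
      contMDiffOn_iff_contDiffOn.mp (hf₁.comp_contMDiffOn (contMDiffOn_extChartAt_symm x.1))
    have c₂ : ContDiffOn ℝ ∞ (f₂ ∘ (extChartAt I₂ x.2).symm) (extChartAt I₂ x.2).target :=
      contMDiffOn_iff_contDiffOn.mp (hf₂.comp_contMDiffOn (contMDiffOn_extChartAt_symm x.2))
    have d₁ := (g₁.smooth x.1).comp contDiff_fst.contDiffOn fun y hy => (e y hy).1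
    have d₂ := (g₂.smooth x.2).comp contDiff_snd.contDiffOn fun y hy => (e y hy).2
    have k₁ := c₁.comp contDiff_fst.contDiffOn fun y hy => (e y hy).1
    have k₂ := c₂.comp contDiff_snd.contDiffOn fun y hy => (e y hy).2
    refine ContDiffOn.congr ?_ fun y hy =>
      formInChart_doublyWarpedForm g₁ g₂ f₁ f₂ x (e y hy).1 (e y hy).2
    refine ((k₂.pow 2).smul (contDiffOn_bilinearComp d₁ _)).add
      ((k₁.pow 2).smul (contDiffOn_bilinearComp d₂ _))

end DoublyWarped

end

/-! Everything happens at one point of a slice `M₁ × {q}`. There, with `N = |∇f₂|²`, the Ricci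
tensor of the product restricted to vectors tangent to `M₁` is `Ric₁ - F¹ - (f₂^◇ / f₁²) g₁`, and
its mixed part is `(n - 2) Y(f₁) W(f₂) / (f₁ f₂)` (`ricci_inl_inl`, `ricci_inl_inr`). The slice is
totally umbilical: `D_X Y` is `D¹_X Y` minus `(f₂ / f₁²) g₁(X, Y) ∇f₂`.

In `(D_X Ric)(Y, Z)` two corrections to `D¹_X (Ric₁ - F¹)` therefore appear (`covDeriv_ricci_inl`).
Differentiating `f₁⁻²` gives `2 f₂^◇ X(f₁) g₁(Y, Z) / f₁³`, and the normal part of `D`, fed into the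
mixed Ricci tensor, gives `(n - 2) N / f₁³` times `g₁(X, Y) Z(f₁) + g₁(X, Z) Y(f₁)`.
Antisymmetrizing in `X`, `Y` shows that, if the product is of class ℬ, the Codazzi defect of `Ric₁`
equals the difference of the two sides of the stated equation (`codazzi_fst`). The equivalence
follows pointwise.

The computation takes place in the product of the charts at `p` and `q`, evaluated at its centre, so
no change of coordinates is needed. -/

noncomputable section

namespace Coord

/-! ### Levi-Civita calculus of a metric in coordinates -/

section Metric

variable {E : Type*} [NormedAddCommGroup E] [NormedSpace ℝ E]

/-- `G` is the coordinate expression of a pseudo-Riemannian metric on the open set `U`. -/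
structure IsMetricOn (G : E → E →L[ℝ] E →L[ℝ] ℝ) (U : Set E) : Prop where
  isOpen : IsOpen U
  contDiffOn : ContDiffOn ℝ ∞ G U
  symm : ∀ y ∈ U, ∀ u v, G y u v = G y v u
  nondegenerate : ∀ y ∈ U, ∀ u, (∀ v, G y u v = 0) → u = 0

/-- The gradient of `f` with respect to `G`. -/
def grad (G : E → E →L[ℝ] E →L[ℝ] ℝ) (f : E → ℝ) (y : E) : E :=
  sharp G y (fderiv ℝ f y)

namespace IsMetricOn

variable {G : E → E →L[ℝ] E →L[ℝ] ℝ} {U : Set E} {y : E} {f : E → ℝ}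

theorem contDiffAt (hG : IsMetricOn G U) (hy : y ∈ U) : ContDiffAt ℝ ∞ G y :=
  hG.contDiffOn.contDiffAt (hG.isOpen.mem_nhds hy)

theorem contDiffAt_fderiv (hG : IsMetricOn G U) (hy : y ∈ U) : ContDiffAt ℝ ∞ (fderiv ℝ G) y :=
  (hG.contDiffAt hy).fderiv_right (by simp)

theorem differentiableAt (hG : IsMetricOn G U) (hy : y ∈ U) : DifferentiableAt ℝ G y :=
  (hG.contDiffAt hy).differentiableAt (by simp)

theorem fderiv_symm (hG : IsMetricOn G U) (hy : y ∈ U) (u v w : E) :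
    fderiv ℝ G y u v w = fderiv ℝ G y u w v := by
  have h (v w : E) : fderiv ℝ (fun z => G z v w) y u = fderiv ℝ G y u v w := by
    have := ((hG.differentiableAt hy).hasFDerivAt.clm_apply (hasFDerivAt_const v y)).clm_apply
      (hasFDerivAt_const w y)
    simp [this.fderiv]
  rw [← h v w, ← h w v]
  have : (fun z => G z v w) =ᶠ[nhds y] fun z => G z w v := by
    filter_upwards [hG.isOpen.mem_nhds hy] with z hz using hG.symm z hz v w
  rw [this.fderiv_eq]

/-- Nondegeneracy is injectivity, and `E` and its dual have the same finite dimension. Hence the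
`inverse` in `sharp` is a true inverse and not the default value zero. -/
theorem isInvertible [FiniteDimensional ℝ E] (hG : IsMetricOn G U) (hy : y ∈ U) :
    (G y).IsInvertible := by
  have hinj : Function.Injective (G y).toLinearMap := by
    refine (injective_iff_map_eq_zero _).mpr fun u hu => hG.nondegenerate y hy u fun v => ?_
    exact DFunLike.congr_fun hu v
  have hdim : Module.finrank ℝ E = Module.finrank ℝ (E →L[ℝ] ℝ) := by
    rw [← (LinearMap.toContinuousLinearMap : (E →ₗ[ℝ] ℝ) ≃ₗ[ℝ] (E →L[ℝ] ℝ)).finrank_eq]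
    exact (Subspace.dual_finrank_eq (K := ℝ) (V := E)).symm
  exact ⟨(LinearMap.linearEquivOfInjective _ hinj hdim).toContinuousLinearEquiv, by ext; rfl⟩

variable [FiniteDimensional ℝ E]

theorem apply_sharp (hG : IsMetricOn G U) (hy : y ∈ U) (α : E →L[ℝ] ℝ) :
    G y (sharp G y α) = α :=
  (hG.isInvertible hy).self_apply_inverse α

theorem sharp_apply (hG : IsMetricOn G U) (hy : y ∈ U) (v : E) :
    sharp G y (G y v) = v :=
  (hG.isInvertible hy).inverse_apply_self v

/-- Pairing with an arbitrary `w` removes `sharp`, so identities between vectors reduce to the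
Koszul formula. -/
theorem ext_apply (hG : IsMetricOn G U) (hy : y ∈ U) {u v : E} (h : ∀ w, G y u w = G y v w) :
    u = v := by
  rw [← hG.sharp_apply hy u, ← hG.sharp_apply hy v, ContinuousLinearMap.ext h]

theorem apply_christoffel (hG : IsMetricOn G U) (hy : y ∈ U) (u v w : E) :
    G y (christoffel G y u v) w =
      (fderiv ℝ G y u v w + fderiv ℝ G y v u w - fderiv ℝ G y w u v) / 2 := by
  rw [christoffel_apply, hG.apply_sharp hy, christoffelFirst_apply]

theorem christoffel_comm (hG : IsMetricOn G U) (hy : y ∈ U) (u v : E) :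
    christoffel G y u v = christoffel G y v u := by
  refine hG.ext_apply hy fun w => ?_
  rw [hG.apply_christoffel hy, hG.apply_christoffel hy, hG.fderiv_symm hy w u v]
  ring

theorem contDiffAt_sharp (hG : IsMetricOn G U) (hy : y ∈ U) : ContDiffAt ℝ ∞ (sharp G) y :=
  have : CompleteSpace E := FiniteDimensional.complete ℝ E
  (hG.isInvertible hy).contDiffAt_map_inverse.comp y (hG.contDiffAt hy)

theorem contDiffAt_christoffel (hG : IsMetricOn G U) (hy : y ∈ U) :
    ContDiffAt ℝ ∞ (christoffel G) y := by
  have hd := hG.contDiffAt_fderiv hy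
  have hflip : ContDiffAt ℝ ∞ (fun z => (fderiv ℝ G z).flip) y :=
    ((ContinuousLinearMap.flipₗᵢ ℝ E E
      (E →L[ℝ] ℝ)).toContinuousLinearEquiv.contDiff.contDiffAt).comp y hd
  have h1 : ContDiffAt ℝ ∞ (christoffelFirst G) y := by
    refine (contDiffAt_const (c := (1 / 2 : ℝ))).smul ((hd.add hflip).sub ?_)
    exact contDiffAt_const.clm_comp hflip
  exact (contDiffAt_const.clm_apply (hG.contDiffAt_sharp hy)).clm_comp h1

theorem differentiableAt_christoffel (hG : IsMetricOn G U) (hy : y ∈ U) :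
    DifferentiableAt ℝ (christoffel G) y :=
  (hG.contDiffAt_christoffel hy).differentiableAt (by simp)

theorem contDiffAt_ricci (hG : IsMetricOn G U) (hy : y ∈ U) (v w : E) :
    ContDiffAt ℝ ∞ (fun z => ricci G z v w) y := by
  have hC := hG.contDiffAt_christoffel hy
  have hdC : ContDiffAt ℝ ∞ (fderiv ℝ (christoffel G)) y := hC.fderiv_right (by simp)
  have flip' {F F' F'' : Type _} [NormedAddCommGroup F] [NormedSpace ℝ F] [NormedAddCommGroup F']
      [NormedSpace ℝ F'] [NormedAddCommGroup F''] [NormedSpace ℝ F'']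
      {h : E → F →L[ℝ] F' →L[ℝ] F''} (hh : ContDiffAt ℝ ∞ h y) :
      ContDiffAt ℝ ∞ (fun z => (h z).flip) y :=
    ((ContinuousLinearMap.flipₗᵢ ℝ F F' F'').toContinuousLinearEquiv.contDiff.contDiffAt).comp y hh
  have hR : ContDiffAt ℝ ∞ (fun z => riemann G z v w) y := by
    refine ((ContDiffAt.sub ?_ ?_).add ?_).sub ?_
    · exact (flip' ((flip' hdC).clm_apply contDiffAt_const)).clm_apply contDiffAt_const
    · exact (flip' (hdC.clm_apply contDiffAt_const)).clm_apply contDiffAt_const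
    · exact (flip' hC).clm_apply ((hC.clm_apply contDiffAt_const).clm_apply contDiffAt_const)
    · exact (hC.clm_apply contDiffAt_const).clm_comp ((flip' hC).clm_apply contDiffAt_const)
  -- In finite dimension the trace is a continuous linear functional, so smoothness passes from the
  -- curvature operator to `ricci`.
  let tr : (E →L[ℝ] E) →L[ℝ] ℝ :=
    LinearMap.toContinuousLinearMap (LinearMap.trace ℝ E ∘ₗ ContinuousLinearMap.coeLM ℝ)
  exact tr.contDiff.contDiffAt.comp y hR

theorem apply_grad (hG : IsMetricOn G U) (hy : y ∈ U) (v : E) :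
    G y (grad G f y) v = fderiv ℝ f y v := by
  rw [grad, hG.apply_sharp hy]

theorem contDiffAt_grad (hG : IsMetricOn G U) (hy : y ∈ U) (hf : ContDiffAt ℝ ∞ f y) :
    ContDiffAt ℝ ∞ (grad G f) y :=
  (hG.contDiffAt_sharp hy).clm_apply (hf.fderiv_right (by simp))

/-- The covariant derivative of the gradient is the Hessian with one index raised. -/
theorem fderiv_grad_add_christoffel (hG : IsMetricOn G U) (hy : y ∈ U) (hf : ContDiffAt ℝ ∞ f y)
    (u : E) :
    fderiv ℝ (grad G f) y u + christoffel G y u (grad G f y) = sharp G y (hessian G f y u) := by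
  refine hG.ext_apply hy fun w => ?_
  rw [hG.apply_sharp hy, hessian_apply, map_add, add_apply, hG.apply_christoffel hy,
    ← hG.apply_grad hy, hG.symm y hy _ (christoffel G y u w), hG.apply_christoffel hy]
  have hs := (hG.contDiffAt_grad hy hf).differentiableAt (by simp)
  have h1 := ((hG.differentiableAt hy).hasFDerivAt.clm_apply hs.hasFDerivAt).clm_apply
    (hasFDerivAt_const w y)
  have hdf : DifferentiableAt ℝ (fderiv ℝ f) y :=
    (hf.fderiv_right (m := ∞) (by simp)).differentiableAt (by simp)
  have h2 := hdf.hasFDerivAt.clm_apply (hasFDerivAt_const w y)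
  -- The identity `G(grad f, w) = df(w)` holds on a neighbourhood; its two sides are differentiated
  -- and compared.
  have h3 : (fun z => G z (grad G f z) w) =ᶠ[nhds y] fun z => fderiv ℝ f z w := by
    filter_upwards [hG.isOpen.mem_nhds hy] with z hz using hG.apply_grad hz w
  have h4 := DFunLike.congr_fun (h1.unique (h2.congr_of_eventuallyEq h3)) u
  simp at h4
  rw [← h4, hG.fderiv_symm hy u (grad G f y) w]
  ring

/-- The Laplacian enters the Ricci tensor of the product as this divergence of the gradient. -/
theorem trace_fderiv_grad (hG : IsMetricOn G U) (hy : y ∈ U) (hf : ContDiffAt ℝ ∞ f y) :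
    LinearMap.trace ℝ E
      (fderiv ℝ (grad G f) y + (christoffel G y).flip (grad G f y)).toLinearMap =
      laplacian G f y := by
  rw [laplacian]
  congr 1
  ext u
  exact hG.fderiv_grad_add_christoffel hy hf u

end IsMetricOn

end Metric

/-! ### Linearity of the Ricci tensor, metric compatibility, smoothness of the Hessian -/

section Ricci

variable {E : Type*} [NormedAddCommGroup E] [NormedSpace ℝ E]

/-- The shape `v - c • v'` is that of the Christoffel symbol of two vectors tangent to a slice: a
tangential vector minus a multiple of a normal one. -/
theorem ricci_sub_smul_left (G : E → E →L[ℝ] E →L[ℝ] ℝ) (y v v' w : E) (c : ℝ) :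
    ricci G y (v - c • v') w = ricci G y v w - c * ricci G y v' w := by
  have : (riemann G y (v - c • v') w).toLinearMap =
      (riemann G y v w).toLinearMap - c • (riemann G y v' w).toLinearMap := by
    ext u
    simp [riemann_apply]
    module
  rw [ricci, this, map_sub, map_smul]
  rfl

theorem ricci_sub_smul_right (G : E → E →L[ℝ] E →L[ℝ] ℝ) (y v w w' : E) (c : ℝ) :
    ricci G y v (w - c • w') = ricci G y v w - c * ricci G y v w' := by
  have : (riemann G y v (w - c • w')).toLinearMap =
      (riemann G y v w).toLinearMap - c • (riemann G y v w').toLinearMap := by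
    ext u
    simp [riemann_apply]
    module
  rw [ricci, this, map_sub, map_smul]
  rfl

variable [FiniteDimensional ℝ E] {G : E → E →L[ℝ] E →L[ℝ] ℝ} {U : Set E} {y : E} {f : E → ℝ}

/-- Metric compatibility of the connection. It cancels the Christoffel terms in the covariant
derivative of a multiple of `G`. -/
theorem IsMetricOn.fderiv_apply_eq (hG : IsMetricOn G U) (hy : y ∈ U) (u v w : E) :
    fderiv ℝ G y u v w = G y (christoffel G y u v) w + G y v (christoffel G y u w) := by
  rw [hG.symm y hy v, hG.apply_christoffel hy, hG.apply_christoffel hy, hG.fderiv_symm hy u w v,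
    hG.fderiv_symm hy w u v, hG.fderiv_symm hy v u w]
  ring

theorem IsMetricOn.contDiffAt_hessian (hG : IsMetricOn G U) (hy : y ∈ U)
    (hf : ContDiffAt ℝ ∞ f y) : ContDiffAt ℝ ∞ (hessian G f) y := by
  have h1 : ContDiffAt ℝ ∞ (fderiv ℝ f) y := hf.fderiv_right (by simp)
  exact (h1.fderiv_right (m := ∞) (by simp)).sub
    ((contDiffAt_const.clm_apply h1).clm_comp (hG.contDiffAt_christoffel hy))

end Ricci

theorem hasFDerivAt_div {E : Type*} [NormedAddCommGroup E] [NormedSpace ℝ E] {c d : E → ℝ}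
    {c' d' : E →L[ℝ] ℝ} {y : E} (hc : HasFDerivAt c c' y) (hd : HasFDerivAt d d' y)
    (hy : d y ≠ 0) :
    HasFDerivAt (fun z => c z / d z) ((d y)⁻¹ • c' - (c y / d y ^ 2) • d') y := by
  simp only [div_eq_mul_inv]
  refine (hc.mul ((hasDerivAt_inv hy).comp_hasFDerivAt y hd)).congr_fderiv ?_
  ext v
  simp
  field_simp
  ring

/-! ### Doubly warped products in coordinates -/

section Warped

variable {E : Type*} [NormedAddCommGroup E] [NormedSpace ℝ E]
  {E₁ : Type*} [NormedAddCommGroup E₁] [NormedSpace ℝ E₁]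
  {E₂ : Type*} [NormedAddCommGroup E₂] [NormedSpace ℝ E₂]

/-- `E` is the direct sum of `E₁` and `E₂`, with injections `i₁`, `i₂` and projections
`p₁`, `p₂`. -/
structure IsBiproduct (i₁ : E₁ →L[ℝ] E) (p₁ : E →L[ℝ] E₁) (i₂ : E₂ →L[ℝ] E)
    (p₂ : E →L[ℝ] E₂) : Prop where
  fst_inl : ∀ u, p₁ (i₁ u) = u
  snd_inl : ∀ u, p₂ (i₁ u) = 0
  fst_inr : ∀ u, p₁ (i₂ u) = 0
  snd_inr : ∀ u, p₂ (i₂ u) = u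
  total : ∀ v, i₁ (p₁ v) + i₂ (p₂ v) = v

namespace IsBiproduct

variable {i₁ : E₁ →L[ℝ] E} {p₁ : E →L[ℝ] E₁} {i₂ : E₂ →L[ℝ] E} {p₂ : E →L[ℝ] E₂}

theorem swap (h : IsBiproduct i₁ p₁ i₂ p₂) : IsBiproduct i₂ p₂ i₁ p₁ where
  fst_inl := h.snd_inr
  snd_inl := h.fst_inr
  fst_inr := h.snd_inl
  snd_inr := h.fst_inl
  total v := by rw [add_comm, h.total]

/-- Split `A` along `i₁ p₁ + i₂ p₂ = id` and move each injection around the trace by cyclicity. Only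
the diagonal blocks of the curvature then have to be computed. -/
theorem trace_eq [FiniteDimensional ℝ E] [FiniteDimensional ℝ E₁] [FiniteDimensional ℝ E₂]
    (h : IsBiproduct i₁ p₁ i₂ p₂) (A : E →L[ℝ] E) :
    LinearMap.trace ℝ E A.toLinearMap =
      LinearMap.trace ℝ E₁ (p₁ ∘L A ∘L i₁).toLinearMap
        + LinearMap.trace ℝ E₂ (p₂ ∘L A ∘L i₂).toLinearMap := by
  have e : A.toLinearMap = i₁.toLinearMap ∘ₗ (p₁ ∘L A).toLinearMap
      + i₂.toLinearMap ∘ₗ (p₂ ∘L A).toLinearMap := by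
    ext v
    exact (h.total (A v)).symm
  rw [e, map_add, LinearMap.trace_comp_comm' _ i₁.toLinearMap,
    LinearMap.trace_comp_comm' _ i₂.toLinearMap]
  rfl

end IsBiproduct

/-- Near the points of `U₁ × U₂`, the metric `G` is the doubly warped product of `G₁` and `G₂` with
warping functions `φ₁` and `φ₂`. -/
structure IsDoublyWarped (i₁ : E₁ →L[ℝ] E) (p₁ : E →L[ℝ] E₁) (i₂ : E₂ →L[ℝ] E)
    (p₂ : E →L[ℝ] E₂) (G₁ : E₁ → E₁ →L[ℝ] E₁ →L[ℝ] ℝ) (φ₁ : E₁ → ℝ) (U₁ : Set E₁)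
    (G₂ : E₂ → E₂ →L[ℝ] E₂ →L[ℝ] ℝ) (φ₂ : E₂ → ℝ) (U₂ : Set E₂)
    (G : E → E →L[ℝ] E →L[ℝ] ℝ) : Prop where
  biproduct : IsBiproduct i₁ p₁ i₂ p₂
  metric₁ : IsMetricOn G₁ U₁
  metric₂ : IsMetricOn G₂ U₂
  smooth₁ : ∀ y ∈ U₁, ContDiffAt ℝ ∞ φ₁ y
  smooth₂ : ∀ y ∈ U₂, ContDiffAt ℝ ∞ φ₂ y
  ne_zero₁ : ∀ y ∈ U₁, φ₁ y ≠ 0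
  ne_zero₂ : ∀ y ∈ U₂, φ₂ y ≠ 0
  metric : IsMetricOn G (p₁ ⁻¹' U₁ ∩ p₂ ⁻¹' U₂)
  apply : ∀ y ∈ p₁ ⁻¹' U₁ ∩ p₂ ⁻¹' U₂, ∀ u v, G y u v =
    φ₂ (p₂ y) ^ 2 * G₁ (p₁ y) (p₁ u) (p₁ v) + φ₁ (p₁ y) ^ 2 * G₂ (p₂ y) (p₂ u) (p₂ v)

namespace IsDoublyWarped

variable {i₁ : E₁ →L[ℝ] E} {p₁ : E →L[ℝ] E₁} {i₂ : E₂ →L[ℝ] E} {p₂ : E →L[ℝ] E₂}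
  {G₁ : E₁ → E₁ →L[ℝ] E₁ →L[ℝ] ℝ} {φ₁ : E₁ → ℝ} {U₁ : Set E₁}
  {G₂ : E₂ → E₂ →L[ℝ] E₂ →L[ℝ] ℝ} {φ₂ : E₂ → ℝ} {U₂ : Set E₂}
  {G : E → E →L[ℝ] E →L[ℝ] ℝ} {y : E}

/-- This symmetry is the reason for an abstract biproduct instead of `E₁ × E₂`: exchanging the
factors keeps `E` and `G`, so each formula for the first factor yields the one for the second
without transport. -/
theorem swap (h : IsDoublyWarped i₁ p₁ i₂ p₂ G₁ φ₁ U₁ G₂ φ₂ U₂ G) :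
    IsDoublyWarped i₂ p₂ i₁ p₁ G₂ φ₂ U₂ G₁ φ₁ U₁ G where
  biproduct := h.biproduct.swap
  metric₁ := h.metric₂
  metric₂ := h.metric₁
  smooth₁ := h.smooth₂
  smooth₂ := h.smooth₁
  ne_zero₁ := h.ne_zero₂
  ne_zero₂ := h.ne_zero₁
  metric := by
    rw [Set.inter_comm]
    exact h.metric
  apply y hy u v := by
    rw [h.apply y hy.symm]
    ring

variable (h : IsDoublyWarped i₁ p₁ i₂ p₂ G₁ φ₁ U₁ G₂ φ₂ U₂ G)
  (hy : y ∈ p₁ ⁻¹' U₁ ∩ p₂ ⁻¹' U₂)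

include h hy

theorem differentiableAt₁ : DifferentiableAt ℝ φ₁ (p₁ y) :=
  (h.smooth₁ _ hy.1).differentiableAt (by simp)

theorem differentiableAt_fderiv₁ : DifferentiableAt ℝ (fderiv ℝ φ₁) (p₁ y) :=
  ((h.smooth₁ _ hy.1).fderiv_right (m := ∞) (by simp)).differentiableAt (by simp)

/-- These logarithmic derivatives are the coefficients of the mixed Christoffel symbols. That the
derivative factors through `p₁` makes it vanish along the second factor. -/
theorem hasFDerivAt_fderiv_div (Z : E₁) :
    HasFDerivAt (fun z => fderiv ℝ φ₁ (p₁ z) Z / φ₁ (p₁ z))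
      (((φ₁ (p₁ y))⁻¹ • (fderiv ℝ (fderiv ℝ φ₁) (p₁ y)).flip Z
        - (fderiv ℝ φ₁ (p₁ y) Z / φ₁ (p₁ y) ^ 2) • fderiv ℝ φ₁ (p₁ y)) ∘L p₁) y := by
  have n₁ := h.ne_zero₁ _ hy.1
  have a₁ := (h.differentiableAt₁ hy).hasFDerivAt.comp y p₁.hasFDerivAt
  have b₁ := ((h.differentiableAt_fderiv₁ hy).hasFDerivAt.comp y p₁.hasFDerivAt).clm_apply
    (hasFDerivAt_const Z y)
  refine (hasFDerivAt_div b₁ a₁ n₁).congr_fderiv ?_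
  ext v
  simp

theorem fderiv_apply (u v w : E) :
    fderiv ℝ G y u v w =
      2 * φ₂ (p₂ y) * fderiv ℝ φ₂ (p₂ y) (p₂ u) * G₁ (p₁ y) (p₁ v) (p₁ w)
        + φ₂ (p₂ y) ^ 2 * fderiv ℝ G₁ (p₁ y) (p₁ u) (p₁ v) (p₁ w)
        + 2 * φ₁ (p₁ y) * fderiv ℝ φ₁ (p₁ y) (p₁ u) * G₂ (p₂ y) (p₂ v) (p₂ w)
        + φ₁ (p₁ y) ^ 2 * fderiv ℝ G₂ (p₂ y) (p₂ u) (p₂ v) (p₂ w) := by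
  have a₁ := (h.differentiableAt₁ hy).hasFDerivAt.comp y p₁.hasFDerivAt
  have a₂ := (h.swap.differentiableAt₁ hy.symm).hasFDerivAt.comp y p₂.hasFDerivAt
  have b₁ := (((h.metric₁.differentiableAt hy.1).hasFDerivAt.comp y p₁.hasFDerivAt).clm_apply
    (hasFDerivAt_const (p₁ v) y)).clm_apply (hasFDerivAt_const (p₁ w) y)
  have b₂ := (((h.metric₂.differentiableAt hy.2).hasFDerivAt.comp y p₂.hasFDerivAt).clm_apply
    (hasFDerivAt_const (p₂ v) y)).clm_apply (hasFDerivAt_const (p₂ w) y)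
  have c := ((h.metric.differentiableAt hy).hasFDerivAt.clm_apply (hasFDerivAt_const v y)).clm_apply
    (hasFDerivAt_const w y)
  have e : (fun z => G z v w) =ᶠ[nhds y] fun z => φ₂ (p₂ z) ^ 2 * G₁ (p₁ z) (p₁ v) (p₁ w)
      + φ₁ (p₁ z) ^ 2 * G₂ (p₂ z) (p₂ v) (p₂ w) := by
    filter_upwards [h.metric.isOpen.mem_nhds hy] with z hz using h.apply z hz v w
  have := DFunLike.congr_fun
    (c.unique ((((a₂.pow 2).mul b₁).add ((a₁.pow 2).mul b₂)).congr_of_eventuallyEq e)) u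
  simp at this
  rw [this]
  ring

variable [FiniteDimensional ℝ E]

/-- A projection of a derivative of the Christoffel symbols, computed from any function with which
the projected symbol agrees near the point. -/
theorem map_fderiv_christoffel {F : Type*} [NormedAddCommGroup F] [NormedSpace ℝ F]
    (L : E →L[ℝ] F) (v w : E) {c : E → F} {c' : E →L[ℝ] F} (hc : HasFDerivAt c c' y)
    (e : ∀ z ∈ p₁ ⁻¹' U₁ ∩ p₂ ⁻¹' U₂, L (christoffel G z v w) = c z) (u : E) :
    L (fderiv ℝ (christoffel G) y u v w) = c' u := by
  have a := L.hasFDerivAt.comp y (((h.metric.differentiableAt_christoffel hy).hasFDerivAt.clm_apply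
    (hasFDerivAt_const v y)).clm_apply (hasFDerivAt_const w y))
  have e' : (L ∘ fun z => christoffel G z v w) =ᶠ[nhds y] c := by
    filter_upwards [h.metric.isOpen.mem_nhds hy] with z hz using e z hz
  have := DFunLike.congr_fun (a.unique (hc.congr_of_eventuallyEq e')) u
  simpa using this

/-! ### Connection, curvature and Ricci tensor of the product -/

variable [FiniteDimensional ℝ E₁] [FiniteDimensional ℝ E₂]

/-- Compare with the Koszul formula after pairing with `w`: differentiating the warping factors
along `u` and `v` produces the logarithmic derivatives, along `w` the gradients. -/
theorem christoffel_eq (u v : E) :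
    christoffel G y u v =
      i₁ (christoffel G₁ (p₁ y) (p₁ u) (p₁ v)
        + (fderiv ℝ φ₂ (p₂ y) (p₂ u) / φ₂ (p₂ y)) • p₁ v
        + (fderiv ℝ φ₂ (p₂ y) (p₂ v) / φ₂ (p₂ y)) • p₁ u
        - (φ₁ (p₁ y) / φ₂ (p₂ y) ^ 2 * G₂ (p₂ y) (p₂ u) (p₂ v)) • grad G₁ φ₁ (p₁ y))
      + i₂ (christoffel G₂ (p₂ y) (p₂ u) (p₂ v)
        + (fderiv ℝ φ₁ (p₁ y) (p₁ u) / φ₁ (p₁ y)) • p₂ v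
        + (fderiv ℝ φ₁ (p₁ y) (p₁ v) / φ₁ (p₁ y)) • p₂ u
        - (φ₂ (p₂ y) / φ₁ (p₁ y) ^ 2 * G₁ (p₁ y) (p₁ u) (p₁ v)) • grad G₂ φ₂ (p₂ y)) := by
  have hb := h.biproduct
  have n₁ := h.ne_zero₁ _ hy.1
  have n₂ := h.ne_zero₂ _ hy.2
  refine h.metric.ext_apply hy fun w => ?_
  rw [h.metric.apply_christoffel hy, h.apply y hy]
  simp only [h.fderiv_apply hy, map_add, map_sub, map_smul, hb.fst_inl, hb.snd_inl, hb.fst_inr,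
    hb.snd_inr, add_apply, sub_apply, smul_apply, smul_eq_mul, h.metric₁.apply_christoffel hy.1,
    h.metric₂.apply_christoffel hy.2, h.metric₁.apply_grad hy.1, h.metric₂.apply_grad hy.2,
    add_zero, zero_add, smul_zero, sub_zero]
  field_simp
  ring

/-- The normal part is proportional to `G₁`: slices are totally umbilical. -/
theorem christoffel_inl_inl (u v : E₁) :
    christoffel G y (i₁ u) (i₁ v) = i₁ (christoffel G₁ (p₁ y) u v)
      - (φ₂ (p₂ y) / φ₁ (p₁ y) ^ 2 * G₁ (p₁ y) u v) • i₂ (grad G₂ φ₂ (p₂ y)) := by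
  have hb := h.biproduct
  rw [h.christoffel_eq hy]
  simp [hb.fst_inl, hb.snd_inl, sub_eq_add_neg]

theorem christoffel_inl_inr (u : E₁) (v : E₂) :
    christoffel G y (i₁ u) (i₂ v) = (fderiv ℝ φ₂ (p₂ y) v / φ₂ (p₂ y)) • i₁ u
      + (fderiv ℝ φ₁ (p₁ y) u / φ₁ (p₁ y)) • i₂ v := by
  have hb := h.biproduct
  rw [h.christoffel_eq hy]
  simp [hb.fst_inl, hb.snd_inl, hb.fst_inr, hb.snd_inr]

theorem christoffel_inr_inl (u : E₂) (v : E₁) :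
    christoffel G y (i₂ u) (i₁ v) = (fderiv ℝ φ₂ (p₂ y) u / φ₂ (p₂ y)) • i₁ v
      + (fderiv ℝ φ₁ (p₁ y) v / φ₁ (p₁ y)) • i₂ u := by
  rw [h.metric.christoffel_comm hy, h.christoffel_inl_inr hy]

theorem christoffel_inr_inr (u v : E₂) :
    christoffel G y (i₂ u) (i₂ v) = i₂ (christoffel G₂ (p₂ y) u v)
      - (φ₁ (p₁ y) / φ₂ (p₂ y) ^ 2 * G₂ (p₂ y) u v) • i₁ (grad G₁ φ₁ (p₁ y)) :=
  h.swap.christoffel_inl_inl hy.symm u v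

/-- A Gauss equation: the tangential symbols are those of `G₁`, so the only corrections are the
quadratic terms that leave the slice through its normal part and return. -/
theorem fst_riemann_inl_inl (u Y Z : E₁) :
    p₁ (riemann G y (i₁ Y) (i₁ Z) (i₁ u)) =
      riemann G₁ (p₁ y) Y Z u
        - (fderiv ℝ φ₂ (p₂ y) (grad G₂ φ₂ (p₂ y)) / φ₁ (p₁ y) ^ 2 * G₁ (p₁ y) Y Z) • u
        + (fderiv ℝ φ₂ (p₂ y) (grad G₂ φ₂ (p₂ y)) / φ₁ (p₁ y) ^ 2 * G₁ (p₁ y) Z u) • Y := by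
  have hb := h.biproduct
  have n₂ := h.ne_zero₂ _ hy.2
  have d (v w : E₁) (u : E) : p₁ (fderiv ℝ (christoffel G) y u (i₁ v) (i₁ w)) =
      fderiv ℝ (christoffel G₁) (p₁ y) (p₁ u) v w := by
    have a := (((h.metric₁.differentiableAt_christoffel hy.1).hasFDerivAt.comp y
      p₁.hasFDerivAt).clm_apply (hasFDerivAt_const v y)).clm_apply (hasFDerivAt_const w y)
    rw [h.map_fderiv_christoffel hy p₁ (i₁ v) (i₁ w) a fun z hz => by
      simp [h.christoffel_inl_inl hz, hb.fst_inl, hb.fst_inr]]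
    simp
  rw [riemann_apply, riemann_apply, map_sub, map_add, map_sub, d, d, h.christoffel_inl_inl hy,
    h.christoffel_inl_inl hy, h.metric₁.symm _ hy.1 Z u]
  simp only [map_sub, map_add, map_smul, h.christoffel_inl_inl hy, h.christoffel_inl_inr hy,
    hb.fst_inl, hb.fst_inr, smul_zero, sub_zero, add_zero]
  match_scalars <;> field_simp

/-- The Christoffel terms complete the second derivative of `φ₁` to its Hessian and the derivative
of `grad G₂ φ₂` to a covariant derivative; the remaining products of first derivatives cancel. -/
theorem snd_riemann_inl_inl (u : E₂) (Y Z : E₁) :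
    p₂ (riemann G y (i₁ Y) (i₁ Z) (i₂ u)) =
      -(φ₂ (p₂ y) / φ₁ (p₁ y) ^ 2 * G₁ (p₁ y) Y Z) •
        (fderiv ℝ (grad G₂ φ₂) (p₂ y) u + christoffel G₂ (p₂ y) u (grad G₂ φ₂ (p₂ y)))
      - (hessian G₁ φ₁ (p₁ y) Y Z / φ₁ (p₁ y)) • u := by
  have hb := h.biproduct
  have n₁ := h.ne_zero₁ _ hy.1
  have n₂ := h.ne_zero₂ _ hy.2
  have a₁ := (h.differentiableAt₁ hy).hasFDerivAt.comp y p₁.hasFDerivAt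
  have a₂ := (h.swap.differentiableAt₁ hy.symm).hasFDerivAt.comp y p₂.hasFDerivAt
  have as := ((h.metric₂.contDiffAt_grad hy.2 (h.smooth₂ _ hy.2)).differentiableAt
    (by simp)).hasFDerivAt.comp y p₂.hasFDerivAt
  have b₁ := (((h.metric₁.differentiableAt hy.1).hasFDerivAt.comp y p₁.hasFDerivAt).clm_apply
    (hasFDerivAt_const Y y)).clm_apply (hasFDerivAt_const Z y)
  have d₁ : p₂ (fderiv ℝ (christoffel G) y (i₂ u) (i₁ Y) (i₁ Z)) =
      -(G₁ (p₁ y) Y Z / φ₁ (p₁ y) ^ 2) • (φ₂ (p₂ y) • fderiv ℝ (grad G₂ φ₂) (p₂ y) u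
        + fderiv ℝ φ₂ (p₂ y) u • grad G₂ φ₂ (p₂ y)) := by
    rw [h.map_fderiv_christoffel hy p₂ (i₁ Y) (i₁ Z)
      (((hasFDerivAt_div a₂ (a₁.pow 2) (pow_ne_zero 2 n₁)).mul b₁).smul as).neg fun z hz => by
        simp [h.christoffel_inl_inl hz, hb.snd_inl, hb.snd_inr]]
    simp [hb.fst_inr, hb.snd_inr]
    match_scalars <;> field_simp
  have d₂ : p₂ (fderiv ℝ (christoffel G) y (i₁ Y) (i₂ u) (i₁ Z)) =
      (fderiv ℝ (fderiv ℝ φ₁) (p₁ y) Y Z / φ₁ (p₁ y)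
        - fderiv ℝ φ₁ (p₁ y) Y * fderiv ℝ φ₁ (p₁ y) Z / φ₁ (p₁ y) ^ 2) • u := by
    rw [h.map_fderiv_christoffel hy p₂ (i₂ u) (i₁ Z)
      ((h.hasFDerivAt_fderiv_div hy Z).smul_const u) fun z hz => by
        simp [h.christoffel_inr_inl hz, hb.snd_inl, hb.snd_inr]]
    simp [hb.fst_inl]
    match_scalars
    field_simp
  rw [riemann_apply, map_sub, map_add, map_sub, d₁, d₂, hessian_apply, h.christoffel_inl_inl hy,
    h.christoffel_inr_inl hy]
  simp only [map_sub, map_add, map_smul, h.christoffel_inl_inl hy, h.christoffel_inl_inr hy,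
    h.christoffel_inr_inl hy, h.christoffel_inr_inr hy, hb.snd_inl, hb.snd_inr, smul_zero, sub_zero,
    zero_sub, zero_add]
  match_scalars <;> field_simp <;> ring

/-- No second derivatives survive in the mixed blocks: each projected symbol that is differentiated
depends on one factor only, and the derivative is along the other. -/
theorem fst_riemann_inl_inr (u Y : E₁) (W : E₂) :
    p₁ (riemann G y (i₁ Y) (i₂ W) (i₁ u)) =
      (fderiv ℝ φ₁ (p₁ y) Y / φ₁ (p₁ y) * (fderiv ℝ φ₂ (p₂ y) W / φ₂ (p₂ y))) • u
        - (fderiv ℝ φ₁ (p₁ y) u / φ₁ (p₁ y) * (fderiv ℝ φ₂ (p₂ y) W / φ₂ (p₂ y))) • Y := by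
  have hb := h.biproduct
  have d (u v : E₁) : p₁ (fderiv ℝ (christoffel G) y (i₁ u) (i₁ v) (i₂ W)) = 0 := by
    rw [h.map_fderiv_christoffel hy p₁ (i₁ v) (i₂ W)
      ((h.swap.hasFDerivAt_fderiv_div hy.symm W).smul_const v) fun z hz => by
        simp [h.christoffel_inl_inr hz, hb.fst_inl, hb.fst_inr]]
    simp [hb.snd_inl]
  rw [riemann_apply, map_sub, map_add, map_sub, d, d, h.christoffel_inl_inr hy,
    h.christoffel_inl_inr hy]
  simp only [map_add, map_sub, map_smul, h.christoffel_inl_inl hy, h.christoffel_inl_inr hy,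
    hb.fst_inl, hb.fst_inr, smul_zero, sub_zero, add_zero, h.metric₁.christoffel_comm hy.1 Y u]
  module

theorem snd_riemann_inl_inr (u : E₂) (Y : E₁) (W : E₂) :
    p₂ (riemann G y (i₁ Y) (i₂ W) (i₂ u)) =
      (fderiv ℝ φ₁ (p₁ y) Y / φ₁ (p₁ y) * (fderiv ℝ φ₂ (p₂ y) W / φ₂ (p₂ y))) • u
        - (fderiv ℝ φ₁ (p₁ y) Y / φ₁ (p₁ y) * (G₂ (p₂ y) W u / φ₂ (p₂ y))) •
          grad G₂ φ₂ (p₂ y) := by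
  have hb := h.biproduct
  have n₁ := h.ne_zero₁ _ hy.1
  have n₂ := h.ne_zero₂ _ hy.2
  have d₁ : p₂ (fderiv ℝ (christoffel G) y (i₂ u) (i₁ Y) (i₂ W)) = 0 := by
    rw [h.map_fderiv_christoffel hy p₂ (i₁ Y) (i₂ W)
      ((h.hasFDerivAt_fderiv_div hy Y).smul_const W) fun z hz => by
        simp [h.christoffel_inl_inr hz, hb.snd_inl, hb.snd_inr]]
    simp [hb.fst_inr]
  have d₂ : p₂ (fderiv ℝ (christoffel G) y (i₁ Y) (i₂ u) (i₂ W)) = 0 := by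
    have a := (((h.metric₂.differentiableAt_christoffel hy.2).hasFDerivAt.comp y
      p₂.hasFDerivAt).clm_apply (hasFDerivAt_const u y)).clm_apply (hasFDerivAt_const W y)
    rw [h.map_fderiv_christoffel hy p₂ (i₂ u) (i₂ W) a fun z hz => by
      simp [h.christoffel_inr_inr hz, hb.snd_inl, hb.snd_inr]]
    simp [hb.snd_inl]
  rw [riemann_apply, map_sub, map_add, map_sub, d₁, d₂, h.christoffel_inl_inr hy,
    h.christoffel_inr_inr hy, h.metric₂.symm _ hy.2 W u]
  simp only [map_add, map_sub, map_smul, h.christoffel_inl_inl hy, h.christoffel_inl_inr hy,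
    h.christoffel_inr_inl hy, h.christoffel_inr_inr hy, hb.snd_inl, hb.snd_inr, smul_zero, sub_zero,
    zero_sub, zero_add, h.metric₁.symm _ hy.1 Y (grad G₁ φ₁ (p₁ y)), h.metric₁.apply_grad hy.1]
  match_scalars <;> field_simp
  ring

/-- In the first block the identity contributes `n₁` and the rank-one term takes away one, whence
`n₁ - 1`. The second block contributes the divergence of the gradient and `n₂` copies of the Hessian
term. -/
theorem ricci_inl_inl (Y Z : E₁) :
    ricci G y (i₁ Y) (i₁ Z) =
      ricci G₁ (p₁ y) Y Z
        - Module.finrank ℝ E₂ / φ₁ (p₁ y) * hessian G₁ φ₁ (p₁ y) Y Z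
        - (φ₂ (p₂ y) * laplacian G₂ φ₂ (p₂ y) + ((Module.finrank ℝ E₁ : ℝ) - 1)
            * fderiv ℝ φ₂ (p₂ y) (grad G₂ φ₂ (p₂ y))) / φ₁ (p₁ y) ^ 2 * G₁ (p₁ y) Y Z := by
  set N := fderiv ℝ φ₂ (p₂ y) (grad G₂ φ₂ (p₂ y)) with hN
  have e₁ : (p₁ ∘L riemann G y (i₁ Y) (i₁ Z) ∘L i₁).toLinearMap =
      (riemann G₁ (p₁ y) Y Z).toLinearMap
        - (N / φ₁ (p₁ y) ^ 2 * G₁ (p₁ y) Y Z) • LinearMap.id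
        + (N / φ₁ (p₁ y) ^ 2) • (G₁ (p₁ y) Z).toLinearMap.smulRight Y := by
    ext u
    simp [h.fst_riemann_inl_inl hy, hN, mul_smul]
  have e₂ : (p₂ ∘L riemann G y (i₁ Y) (i₁ Z) ∘L i₂).toLinearMap =
      -(φ₂ (p₂ y) / φ₁ (p₁ y) ^ 2 * G₁ (p₁ y) Y Z) •
        (fderiv ℝ (grad G₂ φ₂) (p₂ y)
          + (christoffel G₂ (p₂ y)).flip (grad G₂ φ₂ (p₂ y))).toLinearMap
      - (hessian G₁ φ₁ (p₁ y) Y Z / φ₁ (p₁ y)) • LinearMap.id := by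
    ext u
    simp [h.snd_riemann_inl_inl hy]
  rw [ricci, h.biproduct.trace_eq, e₁, e₂]
  simp only [map_add, map_sub, map_smul, LinearMap.trace_smulRight, LinearMap.trace_id,
    h.metric₂.trace_fderiv_grad hy.2 (h.smooth₂ _ hy.2), ricci, smul_eq_mul]
  simp only [ContinuousLinearMap.coe_coe, h.metric₁.symm _ hy.1 Z Y]
  ring

/-- Each block is `a * b` times the identity minus a rank-one map of trace `a * b`; the two rank-one
maps account for the `- 2`. -/
theorem ricci_inl_inr (Y : E₁) (W : E₂) :
    ricci G y (i₁ Y) (i₂ W) =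
      ((Module.finrank ℝ E₁ : ℝ) + Module.finrank ℝ E₂ - 2)
        * (fderiv ℝ φ₁ (p₁ y) Y / φ₁ (p₁ y)) * (fderiv ℝ φ₂ (p₂ y) W / φ₂ (p₂ y)) := by
  set a := fderiv ℝ φ₁ (p₁ y) Y / φ₁ (p₁ y) with ha
  set b := fderiv ℝ φ₂ (p₂ y) W / φ₂ (p₂ y) with hb
  have e₁ : (p₁ ∘L riemann G y (i₁ Y) (i₂ W) ∘L i₁).toLinearMap =
      (a * b) • LinearMap.id
        - (b / φ₁ (p₁ y)) • (fderiv ℝ φ₁ (p₁ y)).toLinearMap.smulRight Y := by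
    ext u
    simp [h.fst_riemann_inl_inr hy, ha, hb]
    module
  have e₂ : (p₂ ∘L riemann G y (i₁ Y) (i₂ W) ∘L i₂).toLinearMap =
      (a * b) • LinearMap.id
        - (a / φ₂ (p₂ y)) • (G₂ (p₂ y) W).toLinearMap.smulRight (grad G₂ φ₂ (p₂ y)) := by
    ext u
    simp [h.snd_riemann_inl_inr hy, ha, hb]
    module
  rw [ricci, h.biproduct.trace_eq, e₁, e₂]
  simp only [map_sub, map_smul, LinearMap.trace_smulRight, LinearMap.trace_id, smul_eq_mul]
  simp only [ContinuousLinearMap.coe_coe, h.metric₂.symm _ hy.2 W, h.metric₂.apply_grad hy.2]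
  rw [ha, hb]
  ring

theorem ricci_inr_inl (W : E₂) (Y : E₁) :
    ricci G y (i₂ W) (i₁ Y) =
      ((Module.finrank ℝ E₁ : ℝ) + Module.finrank ℝ E₂ - 2)
        * (fderiv ℝ φ₁ (p₁ y) Y / φ₁ (p₁ y)) * (fderiv ℝ φ₂ (p₂ y) W / φ₂ (p₂ y)) := by
  rw [h.swap.ricci_inl_inr hy.symm]
  ring

theorem fderiv_ricci_inl (X Y Z : E₁) :
    fderiv ℝ (fun z => ricci G z (i₁ Y) (i₁ Z)) y (i₁ X) =
      fderiv ℝ (fun z => ricci G₁ z Y Z) (p₁ y) X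
        - fderiv ℝ (fun z => Module.finrank ℝ E₂ / φ₁ z * hessian G₁ φ₁ z Y Z) (p₁ y) X
        - (φ₂ (p₂ y) * laplacian G₂ φ₂ (p₂ y) + ((Module.finrank ℝ E₁ : ℝ) - 1)
            * fderiv ℝ φ₂ (p₂ y) (grad G₂ φ₂ (p₂ y))) / φ₁ (p₁ y) ^ 2
          * (fderiv ℝ G₁ (p₁ y) X Y Z
            - 2 / φ₁ (p₁ y) * fderiv ℝ φ₁ (p₁ y) X * G₁ (p₁ y) Y Z) := by
  have hb := h.biproduct
  have n₁ := h.ne_zero₁ _ hy.1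
  set K := φ₂ (p₂ y) * laplacian G₂ φ₂ (p₂ y) + ((Module.finrank ℝ E₁ : ℝ) - 1)
    * fderiv ℝ φ₂ (p₂ y) (grad G₂ φ₂ (p₂ y)) with hK
  -- `j` parametrizes the slice through `y`. The direction `i₁ X` is tangent to it and `K` is
  -- constant along it, so `K` never has to be differentiated.
  set j : E₁ → E := fun x => i₁ x + i₂ (p₂ y) with hj
  have hj₁ (x : E₁) : p₁ (j x) = x := by simp [hj, hb.fst_inl, hb.fst_inr]
  have hj₂ (x : E₁) : p₂ (j x) = p₂ y := by simp [hj, hb.snd_inl, hb.snd_inr]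
  have hjy : j (p₁ y) = y := hb.total y
  have dj : HasFDerivAt j i₁ (p₁ y) := i₁.hasFDerivAt.add_const _
  have dr : HasFDerivAt (fun z => ricci G z (i₁ Y) (i₁ Z))
      (fderiv ℝ (fun z => ricci G z (i₁ Y) (i₁ Z)) y) (j (p₁ y)) := by
    rw [hjy]
    exact ((h.metric.contDiffAt_ricci hy _ _).differentiableAt (by simp)).hasFDerivAt
  have a := (h.differentiableAt₁ hy).hasFDerivAt
  have r₁ := ((h.metric₁.contDiffAt_ricci hy.1 Y Z).differentiableAt (by simp)).hasFDerivAt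
  have b₁ := ((h.metric₁.differentiableAt hy.1).hasFDerivAt.clm_apply
    (hasFDerivAt_const Y (p₁ y))).clm_apply (hasFDerivAt_const Z (p₁ y))
  have F₁ : DifferentiableAt ℝ (fun z => Module.finrank ℝ E₂ / φ₁ z * hessian G₁ φ₁ z Y Z)
      (p₁ y) := by
    have hH : DifferentiableAt ℝ (hessian G₁ φ₁) (p₁ y) :=
      (h.metric₁.contDiffAt_hessian hy.1 (h.smooth₁ _ hy.1)).differentiableAt (by simp)
    exact (hasFDerivAt_div (hasFDerivAt_const _ _) a n₁).differentiableAt.mul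
      ((hH.clm_apply (differentiableAt_const Y)).clm_apply (differentiableAt_const Z))
  have k := (hasFDerivAt_div (hasFDerivAt_const K (p₁ y)) (a.pow 2) (pow_ne_zero 2 n₁)).mul b₁
  have e : (fun z => ricci G z (i₁ Y) (i₁ Z)) ∘ j =ᶠ[nhds (p₁ y)] fun x => ricci G₁ x Y Z
      - Module.finrank ℝ E₂ / φ₁ x * hessian G₁ φ₁ x Y Z - K / φ₁ x ^ 2 * G₁ x Y Z := by
    filter_upwards [h.metric₁.isOpen.mem_nhds hy.1] with x hx
    have hm : j x ∈ p₁ ⁻¹' U₁ ∩ p₂ ⁻¹' U₂ := by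
      rw [Set.mem_inter_iff, Set.mem_preimage, Set.mem_preimage, hj₁, hj₂]
      exact ⟨hx, hy.2⟩
    rw [Function.comp_apply, h.ricci_inl_inl hm, hj₁, hj₂]
  have := DFunLike.congr_fun ((dr.comp _ dj).unique
    (((r₁.sub F₁.hasFDerivAt).sub k).congr_of_eventuallyEq e)) X
  simp at this
  rw [this]
  field_simp
  ring

/-- The term with factor `2` comes from differentiating `φ₁⁻²`, the last one from the normal parts
of the two Christoffel terms inserted in the mixed Ricci tensor. -/
theorem covDeriv_ricci_inl (X Y Z : E₁) :
    covDeriv G (ricci G) y (i₁ X) (i₁ Y) (i₁ Z) =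
      covDeriv G₁ (ricci G₁) (p₁ y) X Y Z
        - covDeriv G₁ (fun z v w => Module.finrank ℝ E₂ / φ₁ z * hessian G₁ φ₁ z v w) (p₁ y) X Y Z
        + 2 * (φ₂ (p₂ y) * laplacian G₂ φ₂ (p₂ y) + ((Module.finrank ℝ E₁ : ℝ) - 1)
            * fderiv ℝ φ₂ (p₂ y) (grad G₂ φ₂ (p₂ y))) / φ₁ (p₁ y) ^ 3
          * fderiv ℝ φ₁ (p₁ y) X * G₁ (p₁ y) Y Z
        + ((Module.finrank ℝ E₁ : ℝ) + Module.finrank ℝ E₂ - 2)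
          * fderiv ℝ φ₂ (p₂ y) (grad G₂ φ₂ (p₂ y)) / φ₁ (p₁ y) ^ 3
          * (G₁ (p₁ y) X Y * fderiv ℝ φ₁ (p₁ y) Z + G₁ (p₁ y) X Z * fderiv ℝ φ₁ (p₁ y) Y) := by
  have n₁ := h.ne_zero₁ _ hy.1
  have n₂ := h.ne_zero₂ _ hy.2
  rw [covDeriv, covDeriv, covDeriv, h.fderiv_ricci_inl hy, h.christoffel_inl_inl hy,
    h.christoffel_inl_inl hy, ricci_sub_smul_left, ricci_sub_smul_right, h.ricci_inl_inl hy,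
    h.ricci_inl_inl hy, h.ricci_inl_inr hy, h.ricci_inr_inl hy, h.metric₁.fderiv_apply_eq hy.1]
  field_simp
  ring

/-- If the Ricci tensor of a doubly warped product is a Codazzi tensor, this is the failure of the
Ricci tensor of the first factor to be one. -/
theorem codazzi_fst (X Y Z : E₁)
    (hB : covDeriv G (ricci G) y (i₁ X) (i₁ Y) (i₁ Z) =
      covDeriv G (ricci G) y (i₁ Y) (i₁ X) (i₁ Z)) :
    let F := fun z v w => Module.finrank ℝ E₂ / φ₁ z * hessian G₁ φ₁ z v w
    let K := 2 * (φ₂ (p₂ y) * laplacian G₂ φ₂ (p₂ y) + ((Module.finrank ℝ E₁ : ℝ) - 1)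
        * fderiv ℝ φ₂ (p₂ y) (grad G₂ φ₂ (p₂ y)))
      - ((Module.finrank ℝ E₁ : ℝ) + Module.finrank ℝ E₂ - 2)
        * fderiv ℝ φ₂ (p₂ y) (grad G₂ φ₂ (p₂ y))
    covDeriv G₁ (ricci G₁) (p₁ y) X Y Z - covDeriv G₁ (ricci G₁) (p₁ y) Y X Z =
      covDeriv G₁ F (p₁ y) X Y Z - (covDeriv G₁ F (p₁ y) Y X Z
        + 1 / φ₁ (p₁ y) ^ 3 * fderiv ℝ φ₁ (p₁ y) X * G₁ (p₁ y) Y Z * K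
        - 1 / φ₁ (p₁ y) ^ 3 * fderiv ℝ φ₁ (p₁ y) Y * G₁ (p₁ y) X Z * K) := by
  intro F K
  -- The term `G₁(X, Y) dφ₁(Z)` is symmetric and drops out. Its companion `G₁(X, Z) dφ₁(Y)` has `X`
  -- and `Y` exchanged relative to the `2 / φ₁³` term, hence the minus sign in `K`.
  rw [h.covDeriv_ricci_inl hy, h.covDeriv_ricci_inl hy, h.metric₁.symm _ hy.1 Y X] at hB
  linear_combination hB

end IsDoublyWarped

end Warped

end Coord

/-! ### From coordinates to manifolds -/

section Manifold

variable {E : Type*} [NormedAddCommGroup E] [NormedSpace ℝ E]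
  {H : Type*} [TopologicalSpace H] {I : ModelWithCorners ℝ E H}
  {M : Type*} [TopologicalSpace M] [ChartedSpace H M]

/-- At its own centre the inverse chart has the identity as derivative, because the tangent space at
`x` is identified with `E` through that chart. -/
theorem formInChart_self [IsManifold I ∞ M] (b : M → E →L[ℝ] E →L[ℝ] ℝ) (x : M) :
    formInChart I b x (extChartAt I x x) = b x := by
  have hD : ∀ u : E, mfderivWithin 𝓘(ℝ, E) I (extChartAt I x).symm (Set.range I)
      (extChartAt I x x) u = u := fun u =>
    DFunLike.congr_fun (mfderivWithin_range_extChartAt_symm (I := I) (x := x)) u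
  ext u v
  have h : formInChart I b x (extChartAt I x x) u v = b ((extChartAt I x).symm (extChartAt I x x))
      (mfderivWithin 𝓘(ℝ, E) I (extChartAt I x).symm (Set.range I) (extChartAt I x x) u)
      (mfderivWithin 𝓘(ℝ, E) I (extChartAt I x).symm (Set.range I) (extChartAt I x x) v) := rfl
  rw [h, extChartAt_to_inv]
  exact congrArg₂ (fun u' v' => b x u' v') (hD u) (hD v)

theorem mvfderiv_eq_fderiv [I.Boundaryless] {f : M → ℝ} {x : M}
    (hf : MDifferentiableAt I 𝓘(ℝ, ℝ) f x) (u : TangentSpace I x) :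
    mvfderiv I f x u = fderiv ℝ (f ∘ (extChartAt I x).symm) (extChartAt I x x) u := by
  have h : mfderiv I 𝓘(ℝ, ℝ) f x = fderiv ℝ (f ∘ (extChartAt I x).symm) (extChartAt I x x) := by
    refine hf.mfderiv.trans ?_
    rw [I.range_eq_univ, fderivWithin_univ]
    rfl
  exact DFunLike.congr_fun h u

namespace PseudoRiemannianMetric

variable (g : PseudoRiemannianMetric I M)

theorem inChart_apply (x : M) (y u v : E) :
    g.inChart x y u v = g.val ((extChartAt I x).symm y)
      (mfderivWithin 𝓘(ℝ, E) I (extChartAt I x).symm (Set.range I) y u)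
      (mfderivWithin 𝓘(ℝ, E) I (extChartAt I x).symm (Set.range I) y v) := rfl

/-- Absence of boundary makes the chart target open, and the derivative of the inverse chart is
bijective, which carries nondegeneracy over. -/
theorem isMetricOn_inChart [IsManifold I ∞ M] [I.Boundaryless] (x : M) :
    Coord.IsMetricOn (g.inChart x) (extChartAt I x).target where
  isOpen := isOpen_extChartAt_target x
  contDiffOn := g.smooth x
  symm y _ u v := by
    rw [g.inChart_apply, g.inChart_apply, g.symm]
  nondegenerate y hy u hu := by
    have hA := isInvertible_mfderivWithin_extChartAt_symm (I := I) hy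
    have h0 := g.nondegenerate ((extChartAt I x).symm y)
      (mfderivWithin 𝓘(ℝ, E) I (extChartAt I x).symm (Set.range I) y u) fun v => by
        obtain ⟨w, hw⟩ := hA.bijective.2 v
        rw [← hw]
        exact (g.inChart_apply x y u w).symm.trans (hu w)
    exact hA.bijective.1 (h0.trans (map_zero _).symm)

theorem inChart_self [IsManifold I ∞ M] (x : M) (u v : TangentSpace I x) :
    g.inChart x (extChartAt I x x) u v = g.val x u v :=
  DFunLike.congr_fun (DFunLike.congr_fun (formInChart_self (I := I) g.val x) u) v

theorem gradient_eq_grad [IsManifold I ∞ M] [I.Boundaryless] {f : M → ℝ} {x : M}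
    (hf : MDifferentiableAt I 𝓘(ℝ, ℝ) f x) :
    g.gradient f x =
      Coord.grad (g.inChart x) (f ∘ (extChartAt I x).symm) (extChartAt I x x) := by
  have h1 : g.inChart x (extChartAt I x x) = g.val x := formInChart_self (I := I) g.val x
  have h2 : mvfderiv I f x = fderiv ℝ (f ∘ (extChartAt I x).symm) (extChartAt I x x) :=
    ContinuousLinearMap.ext (mvfderiv_eq_fderiv hf)
  rw [Coord.grad, Coord.sharp, h1, ← h2]
  rfl

theorem val_gradient [IsManifold I ∞ M] [I.Boundaryless] [FiniteDimensional ℝ E] {f : M → ℝ}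
    {x : M} (hf : MDifferentiableAt I 𝓘(ℝ, ℝ) f x) (u : TangentSpace I x) :
    g.val x (g.gradient f x) u = mvfderiv I f x u := by
  rw [← g.inChart_self, g.gradient_eq_grad hf, mvfderiv_eq_fderiv hf]
  exact (g.isMetricOn_inChart x).apply_grad (mem_extChartAt_target x) u

end PseudoRiemannianMetric

end Manifold

/-! ### Doubly warped products of manifolds -/

section DoublyWarped

variable {E₁ : Type*} [NormedAddCommGroup E₁] [NormedSpace ℝ E₁]
  {H₁ : Type*} [TopologicalSpace H₁] {I₁ : ModelWithCorners ℝ E₁ H₁} [I₁.Boundaryless]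
  {M₁ : Type*} [TopologicalSpace M₁] [ChartedSpace H₁ M₁] [IsManifold I₁ ∞ M₁]
  {E₂ : Type*} [NormedAddCommGroup E₂] [NormedSpace ℝ E₂]
  {H₂ : Type*} [TopologicalSpace H₂] {I₂ : ModelWithCorners ℝ E₂ H₂} [I₂.Boundaryless]
  {M₂ : Type*} [TopologicalSpace M₂] [ChartedSpace H₂ M₂] [IsManifold I₂ ∞ M₂]
  (g₁ : PseudoRiemannianMetric I₁ M₁) (g₂ : PseudoRiemannianMetric I₂ M₂)
  {f₁ : M₁ → ℝ} {f₂ : M₂ → ℝ}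

theorem contDiffAt_comp_extChartAt_symm (hf₁ : ContMDiff I₁ 𝓘(ℝ, ℝ) ∞ f₁) (p : M₁) {y : E₁}
    (hy : y ∈ (extChartAt I₁ p).target) : ContDiffAt ℝ ∞ (f₁ ∘ (extChartAt I₁ p).symm) y :=
  (contMDiffOn_iff_contDiffOn.mp (hf₁.comp_contMDiffOn
    (contMDiffOn_extChartAt_symm p))).contDiffAt ((isOpen_extChartAt_target p).mem_nhds hy)

theorem isDoublyWarped_inChart (hf₁ : ContMDiff I₁ 𝓘(ℝ, ℝ) ∞ f₁) (hf₂ : ContMDiff I₂ 𝓘(ℝ, ℝ) ∞ f₂)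
    (hpos₁ : ∀ p, 0 < f₁ p) (hpos₂ : ∀ p, 0 < f₂ p) (p : M₁) (q : M₂) :
    Coord.IsDoublyWarped (ContinuousLinearMap.inl ℝ E₁ E₂) (ContinuousLinearMap.fst ℝ E₁ E₂)
      (ContinuousLinearMap.inr ℝ E₁ E₂) (ContinuousLinearMap.snd ℝ E₁ E₂)
      (g₁.inChart p) (f₁ ∘ (extChartAt I₁ p).symm) (extChartAt I₁ p).target
      (g₂.inChart q) (f₂ ∘ (extChartAt I₂ q).symm) (extChartAt I₂ q).target
      ((doublyWarpedMetric g₁ g₂ f₁ f₂ hf₁ hf₂ hpos₁ hpos₂).inChart (p, q)) where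
  biproduct := ⟨fun _ => rfl, fun _ => rfl, fun _ => rfl, fun _ => rfl, fun v => by simp⟩
  metric₁ := g₁.isMetricOn_inChart p
  metric₂ := g₂.isMetricOn_inChart q
  smooth₁ _ hy := contDiffAt_comp_extChartAt_symm hf₁ p hy
  smooth₂ _ hy := contDiffAt_comp_extChartAt_symm hf₂ q hy
  ne_zero₁ _ _ := (hpos₁ _).ne'
  ne_zero₂ _ _ := (hpos₂ _).ne'
  metric := by
    have h := (doublyWarpedMetric g₁ g₂ f₁ f₂ hf₁ hf₂ hpos₁ hpos₂).isMetricOn_inChart (p, q)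
    rw [extChartAt_prod] at h
    exact h
  apply y hy u v := by
    have h := formInChart_doublyWarpedForm g₁ g₂ f₁ f₂ (p, q) hy.1 hy.2
    exact DFunLike.congr_fun (DFunLike.congr_fun h u) v

variable {E : Type*} [NormedAddCommGroup E] [NormedSpace ℝ E] [FiniteDimensional ℝ E]
  [FiniteDimensional ℝ E₁] [FiniteDimensional ℝ E₂]

/-- The obstruction for the Ricci tensor of the first factor to be a Codazzi tensor when that of
the doubly warped product is one. -/
theorem PseudoRiemannianMetric.codazzi_fst {p : M₁} {q : M₂}
    {i₁ : E₁ →L[ℝ] E} {p₁ : E →L[ℝ] E₁} {i₂ : E₂ →L[ℝ] E} {p₂ : E →L[ℝ] E₂}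
    {G : E → E →L[ℝ] E →L[ℝ] ℝ} {y : E}
    (h : Coord.IsDoublyWarped i₁ p₁ i₂ p₂
      (g₁.inChart p) (f₁ ∘ (extChartAt I₁ p).symm) (extChartAt I₁ p).target
      (g₂.inChart q) (f₂ ∘ (extChartAt I₂ q).symm) (extChartAt I₂ q).target G)
    (hf₁ : MDifferentiableAt I₁ 𝓘(ℝ, ℝ) f₁ p) (hf₂ : MDifferentiableAt I₂ 𝓘(ℝ, ℝ) f₂ q)
    (hy₁ : p₁ y = extChartAt I₁ p p) (hy₂ : p₂ y = extChartAt I₂ q q)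
    (hB : ∀ u v w, Coord.covDeriv G (Coord.ricci G) y u v w =
      Coord.covDeriv G (Coord.ricci G) y v u w)
    {n₁ n₂ n : ℕ} (hn₁ : n₁ = Module.finrank ℝ E₁) (hn₂ : n₂ = Module.finrank ℝ E₂)
    (hn : n = n₁ + n₂) (X Y Z : TangentSpace I₁ p) :
    g₁.covDerivRicci p X Y Z - g₁.covDerivRicci p Y X Z =
      g₁.covDerivF n₂ f₁ p X Y Z - (g₁.covDerivF n₂ f₁ p Y X Z
        + 1 / f₁ p ^ 3 * mvfderiv I₁ f₁ p X * g₁.val p Y Z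
          * (2 * g₂.diamond n₁ f₂ q - ((n : ℝ) - 2) * mvfderiv I₂ f₂ q (g₂.gradient f₂ q))
        - 1 / f₁ p ^ 3 * mvfderiv I₁ f₁ p Y * g₁.val p X Z
          * (2 * g₂.diamond n₁ f₂ q - ((n : ℝ) - 2) * mvfderiv I₂ f₂ q (g₂.gradient f₂ q))) := by
  have hy : y ∈ p₁ ⁻¹' (extChartAt I₁ p).target ∩ p₂ ⁻¹' (extChartAt I₂ q).target := by
    rw [Set.mem_inter_iff, Set.mem_preimage, Set.mem_preimage, hy₁, hy₂]
    exact ⟨mem_extChartAt_target p, mem_extChartAt_target q⟩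
  have key := h.codazzi_fst hy X Y Z (hB _ _ _)
  rw [hy₁, hy₂] at key
  have e₁ : (f₁ ∘ (extChartAt I₁ p).symm) (extChartAt I₁ p p) = f₁ p :=
    congrArg f₁ (extChartAt_to_inv p)
  have e₂ : (f₂ ∘ (extChartAt I₂ q).symm) (extChartAt I₂ q q) = f₂ q :=
    congrArg f₂ (extChartAt_to_inv q)
  have eg := g₂.gradient_eq_grad hf₂
  have eN : fderiv ℝ (f₂ ∘ (extChartAt I₂ q).symm) (extChartAt I₂ q q)
      (Coord.grad (g₂.inChart q) (f₂ ∘ (extChartAt I₂ q).symm) (extChartAt I₂ q q)) =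
      mvfderiv I₂ f₂ q (g₂.gradient f₂ q) := by
    rw [mvfderiv_eq_fderiv hf₂, eg]
  rw [e₁, e₂, eN] at key
  -- `diamond` contains `g₂(∇f₂, ∇f₂)`, the coordinate formula `df₂(∇f₂)`; `val_gradient` identifies
  -- them.
  rw [PseudoRiemannianMetric.diamond, g₂.val_gradient hf₂, mvfderiv_eq_fderiv hf₁,
    mvfderiv_eq_fderiv hf₁, ← g₁.inChart_self, ← g₁.inChart_self, hn, hn₁, hn₂, Nat.cast_add]
  exact key

end DoublyWarped

end

theorem mainTheorem2
    {E₁ : Type*} [NormedAddCommGroup E₁] [NormedSpace ℝ E₁] [FiniteDimensional ℝ E₁]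
    {H₁ : Type*} [TopologicalSpace H₁] {I₁ : ModelWithCorners ℝ E₁ H₁} [I₁.Boundaryless]
    {M₁ : Type*} [TopologicalSpace M₁] [ChartedSpace H₁ M₁] [IsManifold I₁ ∞ M₁] [Nonempty M₁]
    {E₂ : Type*} [NormedAddCommGroup E₂] [NormedSpace ℝ E₂] [FiniteDimensional ℝ E₂]
    {H₂ : Type*} [TopologicalSpace H₂] {I₂ : ModelWithCorners ℝ E₂ H₂} [I₂.Boundaryless]
    {M₂ : Type*} [TopologicalSpace M₂] [ChartedSpace H₂ M₂] [IsManifold I₂ ∞ M₂] [Nonempty M₂]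
    (g₁ : PseudoRiemannianMetric I₁ M₁) (g₂ : PseudoRiemannianMetric I₂ M₂)
    (f₁ : M₁ → ℝ) (f₂ : M₂ → ℝ)
    (hf₁ : ContMDiff I₁ 𝓘(ℝ, ℝ) ∞ f₁) (hf₂ : ContMDiff I₂ 𝓘(ℝ, ℝ) ∞ f₂)
    (hpos₁ : ∀ p, 0 < f₁ p) (hpos₂ : ∀ q, 0 < f₂ q)
    (n₁ n₂ n : ℕ) (hn₁ : n₁ = Module.finrank ℝ E₁) (hn₂ : n₂ = Module.finrank ℝ E₂)
    (hn : n = n₁ + n₂)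
    (hB : (doublyWarpedMetric g₁ g₂ f₁ f₂ hf₁ hf₂ hpos₁ hpos₂).IsClassB) :
    (g₁.IsClassB ↔
      ∀ (p : M₁) (q : M₂) (X Y Z : TangentSpace I₁ p),
        g₁.covDerivF n₂ f₁ p X Y Z = g₁.covDerivF n₂ f₁ p Y X Z
          + 1 / f₁ p ^ 3 * mvfderiv I₁ f₁ p X * g₁.val p Y Z
            * (2 * g₂.diamond n₁ f₂ q - ((n : ℝ) - 2) * mvfderiv I₂ f₂ q (g₂.gradient f₂ q))
          - 1 / f₁ p ^ 3 * mvfderiv I₁ f₁ p Y * g₁.val p X Z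
            * (2 * g₂.diamond n₁ f₂ q - ((n : ℝ) - 2) * mvfderiv I₂ f₂ q (g₂.gradient f₂ q))) ∧
    (g₂.IsClassB ↔
      ∀ (p : M₁) (q : M₂) (X Y Z : TangentSpace I₂ q),
        g₂.covDerivF n₁ f₂ q X Y Z = g₂.covDerivF n₁ f₂ q Y X Z
          + 1 / f₂ q ^ 3 * mvfderiv I₂ f₂ q X * g₂.val q Y Z
            * (2 * g₁.diamond n₂ f₁ p - ((n : ℝ) - 2) * mvfderiv I₁ f₁ p (g₁.gradient f₁ p))
          - 1 / f₂ q ^ 3 * mvfderiv I₂ f₂ q Y * g₂.val q X Z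
            * (2 * g₁.diamond n₂ f₁ p - ((n : ℝ) - 2) * mvfderiv I₁ f₁ p (g₁.gradient f₁ p))) := by
  have d₁ (p : M₁) : MDifferentiableAt I₁ 𝓘(ℝ, ℝ) f₁ p := (hf₁ p).mdifferentiableAt (by simp)
  have d₂ (q : M₂) : MDifferentiableAt I₂ 𝓘(ℝ, ℝ) f₂ q := (hf₂ q).mdifferentiableAt (by simp)
  have hw := isDoublyWarped_inChart g₁ g₂ hf₁ hf₂ hpos₁ hpos₂
  have hy (p : M₁) (q : M₂) : extChartAt (I₁.prod I₂) (p, q) (p, q) =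
      (extChartAt I₁ p p, extChartAt I₂ q q) := by
    rw [extChartAt_prod]
    rfl
  have hy₁ (p : M₁) (q : M₂) : ContinuousLinearMap.fst ℝ E₁ E₂
      (extChartAt (I₁.prod I₂) (p, q) (p, q)) = extChartAt I₁ p p := congrArg Prod.fst (hy p q)
  have hy₂ (p : M₁) (q : M₂) : ContinuousLinearMap.snd ℝ E₁ E₂
      (extChartAt (I₁.prod I₂) (p, q) (p, q)) = extChartAt I₂ q q := congrArg Prod.snd (hy p q)
  constructor
  · have key (p : M₁) (q : M₂) := g₁.codazzi_fst g₂ (hw p q) (d₁ p) (d₂ q) (hy₁ p q) (hy₂ p q)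
      (hB (p, q)) hn₁ hn₂ hn
    refine ⟨fun hg p q X Y Z => ?_, fun hF p X Y Z => ?_⟩
    · rw [← sub_eq_zero, ← key p q X Y Z, sub_eq_zero]
      exact hg p X Y Z
    -- The Codazzi defect of `Ric₁` does not involve `q`, so the equation at a single `q` suffices.
    · obtain ⟨q⟩ := ‹Nonempty M₂›
      rw [← sub_eq_zero, key p q X Y Z, sub_eq_zero]
      exact hF p q X Y Z
  -- The same product metric and chart, with the roles of the factors exchanged.
  · have key (p : M₁) (q : M₂) := g₂.codazzi_fst g₁ (hw p q).swap (d₂ q) (d₁ p) (hy₂ p q) (hy₁ p q)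
      (hB (p, q)) hn₂ hn₁ (hn.trans (add_comm n₁ n₂))
    refine ⟨fun hg p q X Y Z => ?_, fun hF q X Y Z => ?_⟩
    · rw [← sub_eq_zero, ← key p q X Y Z, sub_eq_zero]
      exact hg q X Y Z
    · obtain ⟨p⟩ := ‹Nonempty M₁›
      rw [← sub_eq_zero, key p q X Y Z, sub_eq_zero]
      exact hF p q X Y Z
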